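/- Let $\mathsf A$ be an arbitrary (not necessarily unital) $C^*$-algebra, and let $X$ be a right Hilbert $\mathsf A$-module with inner product $\langle\cdot,\cdot\rangle$, $\mathsf A$-linear in the second variable. For Hilbert $\mathsf A$-modules $Y,Z$ let $\mathbb B(Y,Z)$ be the space of adjointable operators with the operator norm. Let $\ell^2(\mathsf A)$ be the Hilbert $\mathsf A$-module of sequences $(a_n)_{n}$ in $\mathsf A$ for which $\sum_n a_n^*a_n$ converges in norm, with $\langle (a_n)_n,(b_n)_n\rangle=\sum_n a_n^*b_n$. Let $M(X)=\mathbb B(\mathsf A,X)$ be the multiplier module of $X$, where $\mathsf A$ is a Hilbert module over itself via $\langle a,b\rangle=a^*b$; it contains $X$ by identifying $x\in X$ with the operator $a\mapsto xa$. For $v\in M(X)$ and $z\in X$ put $\langle v,z\rangle=v^*(z)\in\mathsf A$ and $\langle z,v\rangle=\langle v,z\rangle^*$; for $v\in X$ this is the inner product of $X$. A sequence $(v_n)_n$ in $M(X)$ is called a *frame or outer frame* for $X$ if there are constants $\alpha,\beta>0$ such that $$\alpha\langle z,z\rangle\le\sum_{n=1}^\infty\langle z,v_n\rangle\langle v_n,z\rangle\le\beta\langle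 z,z\rangle\qquad\text{for all } z\in X,$$ the series converging in the norm of $\mathsf A$; it is a *frame* if all $v_n$ belong to $X$, and an *outer frame* if $v_n\in M(X)\setminus X$ for at least one $n$. Any such $\alpha$ is a *lower frame bound*, the largest one is the *optimal* lower frame bound, and the *analysis operator* of $(v_n)_n$ is $X\to\ell^2(\mathsf A)$, $z\mapsto(\langle v_n,z\rangle)_n$. **Theorem.** Let $(x_n)_n$ be a frame or an outer frame for $X$ with analysis operator $U$ and optimal lower frame bound $A$. Suppose that $V\in\mathbb B(X,\ell^2(\mathsf A))$ satisfies $\|U-V\|<\sqrt A$. Then $V$ is the analysis operator of a frame or an outer frame $(y_n)_n$ for $X$ such that $$\|x_n-y_n\|\le\|U-V\|<\sqrt A\qquad\text{for all } n\in\mathbb N,$$ where $\|x_n-y_n\|$ is computed in $M(X)$. -/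

import Mathlib

noncomputable section

namespace HilbertFrames

open scoped RightActions

set_option linter.unusedSectionVars false

/-! ### Right Hilbert modules

A (right) Hilbert module over the C⋆-algebra `A` is a Banach space `X` carrying Mathlib's
`CStarModule Aᵐᵒᵖ X`: the action of `Aᵐᵒᵖ` is a right action `x <• a = x a` of `A`. -/

section Basic

variable (A : Type*) [NonUnitalCStarAlgebra A] [PartialOrder A] [StarOrderedRing A]
variable {X : Type*} [NormedAddCommGroup X] [NormedSpace ℂ X] [SMul Aᵐᵒᵖ X] [CStarModule Aᵐᵒᵖ X]

/-- The `A`-valued inner product `⟨x, y⟩` of a right Hilbert `A`-module; it is `A`-linear in the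
second variable, see `rinner_smul_right`. -/
def rinner (x y : X) : A := (inner Aᵐᵒᵖ x y).unop

theorem rinner_add_right (x y z : X) : rinner A x (y + z) = rinner A x y + rinner A x z := by
  simp [rinner]

theorem rinner_smul_right (x y : X) (a : A) : rinner A x (y <• a) = rinner A x y * a := by
  simp [rinner]

theorem rinner_csmul_right (c : ℂ) (x y : X) : rinner A x (c • y) = c • rinner A x y := by
  simp [rinner]

theorem star_rinner (x y : X) : star (rinner A x y) = rinner A y x := by
  rw [rinner, ← MulOpposite.unop_star, CStarModule.star_inner]; rfl

theorem rinner_self_nonneg (x : X) : 0 ≤ rinner A x x :=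
  MulOpposite.unop_nonneg.2 CStarModule.inner_self_nonneg

theorem rinner_self {x : X} : rinner A x x = 0 ↔ x = 0 := by
  rw [rinner, MulOpposite.unop_eq_zero_iff, CStarModule.inner_self]

theorem norm_sq_eq_rinner (x : X) : ‖x‖ ^ 2 = ‖rinner A x x‖ :=
  CStarModule.norm_sq_eq Aᵐᵒᵖ

theorem rinner_add_left (x y z : X) : rinner A (x + y) z = rinner A x z + rinner A y z := by
  simp [rinner]

theorem rinner_smul_left (x y : X) (a : A) : rinner A (x <• a) y = star a * rinner A x y := by
  simp [rinner]

theorem rinner_csmul_left (c : ℂ) (x y : X) : rinner A (c • x) y = star c • rinner A x y := by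
  simp [rinner]

theorem rinner_zero_left (y : X) : rinner A (0 : X) y = 0 := by
  simp [rinner]

theorem rinner_sub_right (x y z : X) : rinner A x (y - z) = rinner A x y - rinner A x z := by
  simp [rinner]

theorem eq_of_rinner_right {y z : X} (h : ∀ x : X, rinner A x y = rinner A x z) : y = z := by
  rw [← sub_eq_zero, ← rinner_self A, rinner_sub_right, h, sub_self]

theorem norm_right_smul_le (x : X) (a : A) : ‖x <• a‖ ≤ ‖x‖ * ‖a‖ := by
  refine le_of_sq_le_sq ?_ (by positivity)
  calc ‖x <• a‖ ^ 2 = ‖star a * rinner A x x * a‖ := by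
        rw [norm_sq_eq_rinner A, rinner_smul_right, rinner_smul_left]
    _ ≤ ‖star a‖ * ‖rinner A x x‖ * ‖a‖ :=
        (norm_mul_le _ _).trans (by gcongr; exact norm_mul_le _ _)
    _ = (‖x‖ * ‖a‖) ^ 2 := by rw [← norm_sq_eq_rinner, norm_star]; ring

end Basic

/-! ### Adjointable operators and the multiplier module -/

section Operators

variable (A : Type*) [NonUnitalCStarAlgebra A] [PartialOrder A] [StarOrderedRing A]

/-- `A` as a right Hilbert module over itself: `⟨a, b⟩ = a⋆ b`. -/
instance instSelf : CStarModule Aᵐᵒᵖ A where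
  inner x y := MulOpposite.op (star x * y)
  inner_add_right := by simp [mul_add]
  inner_self_nonneg := MulOpposite.op_nonneg.2 (star_mul_self_nonneg _)
  inner_self := by simp
  inner_op_smul_right {a x y} := by
    apply MulOpposite.unop_injective
    simp [MulOpposite.smul_eq_mul_unop, mul_assoc]
  inner_smul_right_complex := by simp [mul_smul_comm]
  star_inner x y := by simp [← MulOpposite.op_star]
  norm_eq_sqrt_norm_inner_self x := by
    rw [MulOpposite.norm_op, CStarRing.norm_star_mul_self, Real.sqrt_mul_self (norm_nonneg x)]

theorem rinner_def (a b : A) : rinner A a b = star a * b := rfl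

variable (X Y : Type*)
  [NormedAddCommGroup X] [NormedSpace ℂ X] [SMul Aᵐᵒᵖ X] [CStarModule Aᵐᵒᵖ X]
  [NormedAddCommGroup Y] [NormedSpace ℂ Y] [SMul Aᵐᵒᵖ Y] [CStarModule Aᵐᵒᵖ Y]

/-- The space `𝔹(X, Y)` of adjointable operators, with the operator norm. (Between Hilbert modules
a map with an adjoint is automatically `A`-linear and bounded, so that nothing is lost by
starting from bounded `ℂ`-linear maps.) -/
def adjointableOperators : Submodule ℂ (X →L[ℂ] Y) where
  carrier := {T | ∃ S : Y → X, ∀ x y, rinner A (T x) y = rinner A x (S y)}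
  add_mem' := by
    rintro T T' ⟨S, hS⟩ ⟨S', hS'⟩
    exact ⟨fun y => S y + S' y, fun x y => by
      rw [_root_.add_apply, rinner_add_left, rinner_add_right, hS, hS']⟩
  zero_mem' := ⟨fun _ => 0, fun x y => by simp [rinner]⟩
  smul_mem' := by
    rintro c T ⟨S, hS⟩
    exact ⟨fun y => star c • S y, fun x y => by
      rw [_root_.smul_apply, rinner_csmul_left, rinner_csmul_right, hS]⟩

variable {A X Y}

/-- The adjoint `T⋆ : Y → X` of an adjointable operator `T : X → Y`. -/
def adj (T : adjointableOperators A X Y) : Y → X := T.2.choose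

theorem rinner_adj (T : adjointableOperators A X Y) (x : X) (y : Y) :
    rinner A (T.1 x) y = rinner A x (adj T y) := T.2.choose_spec x y

variable (A X)

/-- The multiplier module `M(X) = 𝔹(A, X)` of a right Hilbert `A`-module `X`, with the operator
norm. -/
abbrev MultiplierModule : Type _ := adjointableOperators A A X

variable {X}

/-- The canonical embedding of `X` into `M(X)`: the element `x` is the operator `a ↦ x a`. -/
def toMultiplier (x : X) : MultiplierModule A X :=
  ⟨LinearMap.mkContinuous
    { toFun := fun a : A => x <• a
      map_add' := fun a b => eq_of_rinner_right A fun z => by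
        rw [rinner_add_right]; simp only [rinner_smul_right, mul_add]
      map_smul' := fun c a => eq_of_rinner_right A fun z => by
        rw [RingHom.id_apply, rinner_csmul_right]
        simp only [rinner_smul_right, mul_smul_comm] }
    ‖x‖ (norm_right_smul_le A x),
   fun y => rinner A x y, fun a y => rinner_smul_left A x y a⟩

theorem toMultiplier_apply (x : X) (a : A) : (toMultiplier A x).1 a = x <• a := rfl

variable {A}

/-- The inner product `⟨v, x⟩` of `v ∈ M(X)` with `x ∈ X`, an element of `A`. It is `v⋆ x`, where
`v⋆ : X → A` is the adjoint of `v : A → X`. -/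
def pairing (v : MultiplierModule A X) (x : X) : A := adj v x

theorem rinner_apply_eq_pairing (v : MultiplierModule A X) (a : A) (x : X) :
    rinner A (v.1 a) x = star a * pairing v x := rinner_adj v a x

theorem pairing_unique (v : MultiplierModule A X) (x : X) (b : A)
    (h : ∀ a : A, rinner A (v.1 a) x = star a * b) : pairing v x = b :=
  eq_of_rinner_right A fun a => (rinner_adj v a x).symm.trans (h a)

/-- On elements of `X` the pairing is the inner product of `X`. -/
theorem pairing_toMultiplier (x y : X) : pairing (toMultiplier A x) y = rinner A x y :=
  pairing_unique _ _ _ fun a => rinner_smul_left A x y a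

theorem pairing_add (v : MultiplierModule A X) (x y : X) :
    pairing v (x + y) = pairing v x + pairing v y :=
  pairing_unique _ _ _ fun a => by
    rw [rinner_add_right, rinner_apply_eq_pairing, rinner_apply_eq_pairing, mul_add]

theorem pairing_smul (v : MultiplierModule A X) (c : ℂ) (x : X) :
    pairing v (c • x) = c • pairing v x :=
  pairing_unique _ _ _ fun a => by
    rw [rinner_csmul_right, rinner_apply_eq_pairing, mul_smul_comm]

end Operators

/-! ### The generalized Hilbert space `ℓ²(A)` -/

section EllTwo

variable (A : Type*) [NonUnitalCStarAlgebra A] [PartialOrder A] [StarOrderedRing A]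

/-- If `p n ≤ q n` in the positive cone and `∑ q n` converges, then so does `∑ p n`. -/
theorem summable_of_nonneg_of_le {p q : ℕ → A} (hp : ∀ n, 0 ≤ p n) (hpq : ∀ n, p n ≤ q n)
    (hq : Summable q) : Summable p := by
  rw [summable_iff_vanishing_norm] at hq ⊢
  intro ε hε
  obtain ⟨s, hs⟩ := hq ε hε
  refine ⟨s, fun t ht => lt_of_le_of_lt ?_ (hs t ht)⟩
  exact CStarAlgebra.norm_le_norm_of_nonneg_of_le (Finset.sum_nonneg fun n _ => hp n)
    (Finset.sum_le_sum fun n _ => hpq n)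

/-- The sequences `(a n)` in `A` for which `∑ (a n)⋆ (a n)` converges in norm. (The terms are
positive, so that convergence of this series is the same as unconditional convergence.) -/
def ellTwoSubmodule : Submodule ℂ (ℕ → A) where
  carrier := {a | Summable fun n => star (a n) * a n}
  add_mem' := by
    intro a b ha hb
    refine summable_of_nonneg_of_le A (fun n => star_mul_self_nonneg _) (fun n => ?_)
      ((ha.add hb).add (ha.add hb))
    have h : 0 ≤ star (a n - b n) * (a n - b n) := star_mul_self_nonneg _
    rw [← sub_nonneg]
    convert h using 1
    simp only [Pi.add_apply, star_add, star_sub]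
    noncomm_ring
  zero_mem' := by simp
  smul_mem' := by
    intro c a ha
    have := Summable.const_smul (star c * c) ha
    refine this.congr fun n => ?_
    simp [smul_mul_smul_comm]

/-- The generalized Hilbert space `ℓ²(A)`. -/
def EllTwo : Type _ := ellTwoSubmodule A

namespace EllTwo

instance : AddCommGroup (EllTwo A) := inferInstanceAs (AddCommGroup (ellTwoSubmodule A))
instance : Module ℂ (EllTwo A) := inferInstanceAs (Module ℂ (ellTwoSubmodule A))
instance : CoeFun (EllTwo A) (fun _ => ℕ → A) := ⟨fun a => a.1⟩

variable {A}

theorem ext {a b : EllTwo A} (h : ∀ n, a n = b n) : a = b := Subtype.ext (funext h)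

theorem summable_self (a : EllTwo A) : Summable fun n => star (a n) * a n := a.2

theorem add_apply (a b : EllTwo A) (n : ℕ) : (a + b) n = a n + b n := rfl

theorem smul_apply (c : ℂ) (a : EllTwo A) (n : ℕ) : (c • a) n = c • a n := rfl

/-- The series of inner products `∑ (a n)⋆ (b n)` converges for `a, b ∈ ℓ²(A)`. -/
theorem summable_inner (a b : EllTwo A) : Summable fun n => star (a n) * b n := by
  have key : ∀ c : ℂ, Summable fun n => star (b n + c • a n) * (b n + c • a n) := fun c =>
    summable_self (b + c • a)
  have h := ((((key 1).sub (key (-1))).add ((key Complex.I).const_smul Complex.I)).sub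
    ((key (-Complex.I)).const_smul Complex.I)).const_smul (1 / 4 : ℂ)
  refine h.congr fun n => ?_
  simp only [star_add, star_smul, mul_add, add_mul, smul_mul_assoc, mul_smul_comm, smul_add,
    smul_sub, smul_smul]
  simp only [RCLike.star_def, map_one, map_neg, Complex.conj_I]
  have hI : Complex.I * Complex.I = -1 := Complex.I_mul_I
  match_scalars <;> ring_nf <;> simp <;> norm_num

/-- The right action of `A` on `ℓ²(A)`: `(a n) b = (a n b)`. -/
instance : SMul Aᵐᵒᵖ (EllTwo A) where
  smul b a := ⟨fun n => a n * b.unop, by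
    have h := ((summable_self a).mul_left (star b.unop)).mul_right b.unop
    refine h.congr fun n => ?_
    simp only [star_mul, mul_assoc]⟩

theorem right_smul_apply (a : EllTwo A) (b : A) (n : ℕ) : (a <• b) n = a n * b := rfl

instance : Norm (EllTwo A) where
  norm a := √‖∑' n, star (a n) * a n‖

/-- `ℓ²(A)` as a right Hilbert `A`-module: `⟨a, b⟩ = ∑ (a n)⋆ (b n)`. -/
instance : CStarModule Aᵐᵒᵖ (EllTwo A) where
  inner a b := MulOpposite.op (∑' n, star (a n) * b n)
  inner_add_right {a b c} := by
    rw [← MulOpposite.op_add, ← (summable_inner a b).tsum_add (summable_inner a c)]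
    simp only [add_apply, mul_add]
  inner_self_nonneg := MulOpposite.op_nonneg.2 (tsum_nonneg fun n => star_mul_self_nonneg _)
  inner_self {a} := by
    rw [MulOpposite.op_eq_zero_iff]
    constructor
    · intro h
      refine ext fun n => ?_
      have h1 := (summable_self a).le_tsum n fun m _ => star_mul_self_nonneg (a m)
      rw [h] at h1
      exact (CStarRing.star_mul_self_eq_zero_iff (a n)).1
        (le_antisymm h1 (star_mul_self_nonneg _))
    · rintro rfl
      exact (tsum_congr fun n => show star (0 : A) * 0 = 0 by simp).trans tsum_zero
  inner_op_smul_right {b x y} := by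
    apply MulOpposite.unop_injective
    rw [MulOpposite.unop_mul, MulOpposite.unop_op, MulOpposite.unop_op,
      ← (summable_inner x y).tsum_mul_right]
    exact tsum_congr fun n => (mul_assoc _ _ _).symm
  inner_smul_right_complex {c x y} := by
    rw [← MulOpposite.op_smul, ← (summable_inner x y).tsum_const_smul]
    simp only [smul_apply, mul_smul_comm]
  star_inner x y := by
    rw [← MulOpposite.op_star, tsum_star]
    simp only [star_mul, star_star]
  norm_eq_sqrt_norm_inner_self a := rfl

instance : NormedAddCommGroup (EllTwo A) :=
  NormedAddCommGroup.ofCore (CStarModule.normedSpaceCore Aᵐᵒᵖ)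

instance : NormedSpace ℂ (EllTwo A) := .ofCore (CStarModule.normedSpaceCore Aᵐᵒᵖ)

theorem rinner_def (a b : EllTwo A) : rinner A a b = ∑' n, star (a n) * b n := rfl

theorem norm_sq_eq (a : EllTwo A) : ‖a‖ ^ 2 = ‖∑' n, star (a n) * a n‖ := norm_sq_eq_rinner A a

end EllTwo

end EllTwo

/-! ### Frames, outer frames and their analysis operators -/

section Frames

variable (A : Type*) [NonUnitalCStarAlgebra A] [PartialOrder A] [StarOrderedRing A]
variable {X : Type*} [NormedAddCommGroup X] [NormedSpace ℂ X] [SMul Aᵐᵒᵖ X] [CStarModule Aᵐᵒᵖ X]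

/-- A frame for `X`: a sequence in `X` with
`a ⟨z, z⟩ ≤ ∑ ⟨z, x n⟩ ⟨x n, z⟩ ≤ b ⟨z, z⟩` for all `z ∈ X`, the series converging in the norm
of `A`. (Its terms are positive, so that convergence is the same as unconditional convergence.) -/
def IsFrame (x : ℕ → X) : Prop :=
  ∃ a b : ℝ, 0 < a ∧ 0 < b ∧ ∀ z : X, ∃ s : A,
    HasSum (fun n => rinner A z (x n) * rinner A (x n) z) s ∧
      a • rinner A z z ≤ s ∧ s ≤ b • rinner A z z

variable {A}

/-- The element `⟨z, v⟩ ⟨v, z⟩` of `A`, for `v ∈ M(X)` and `z ∈ X`; here `⟨z, v⟩ = ⟨v, z⟩⋆`. -/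
def frameTerm (v : MultiplierModule A X) (z : X) : A := star (pairing v z) * pairing v z

/-- An outer frame for `X`: a sequence in `M(X)`, not all of whose members lie in `X`, with
`a ⟨z, z⟩ ≤ ∑ ⟨z, v n⟩ ⟨v n, z⟩ ≤ b ⟨z, z⟩` for all `z ∈ X`, the series converging in the norm
of `A`. -/
def IsOuterFrame (v : ℕ → MultiplierModule A X) : Prop :=
  (∃ n, v n ∉ Set.range (toMultiplier A (X := X))) ∧
  ∃ a b : ℝ, 0 < a ∧ 0 < b ∧ ∀ z : X, ∃ s : A,
    HasSum (fun n => frameTerm (v n) z) s ∧ a • rinner A z z ≤ s ∧ s ≤ b • rinner A z z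

/-- The sequence `v` in `M(X)` is a frame for `X` (its members lie in `X`, and form a frame there)
or an outer frame for `X`. -/
def IsFrameOrOuterFrame (v : ℕ → MultiplierModule A X) : Prop :=
  (∃ x : ℕ → X, IsFrame A x ∧ ∀ n, v n = toMultiplier A (x n)) ∨ IsOuterFrame v

/-- `a` is a lower frame bound of `v`: `a > 0` and `a ⟨z, z⟩ ≤ ∑ ⟨z, v n⟩ ⟨v n, z⟩` for all
`z ∈ X`. -/
def IsLowerFrameBound (v : ℕ → MultiplierModule A X) (a : ℝ) : Prop :=
  0 < a ∧ ∀ z : X, ∃ s : A, HasSum (fun n => frameTerm (v n) z) s ∧ a • rinner A z z ≤ s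

/-- The optimal lower frame bound of `v` is the largest one. -/
def IsOptimalLowerFrameBound (v : ℕ → MultiplierModule A X) (a : ℝ) : Prop :=
  IsGreatest {c : ℝ | IsLowerFrameBound v c} a

theorem IsFrameOrOuterFrame.exists_bounds {v : ℕ → MultiplierModule A X}
    (hv : IsFrameOrOuterFrame v) : ∃ a b : ℝ, 0 < a ∧ 0 < b ∧ ∀ z : X, ∃ s : A,
      HasSum (fun n => frameTerm (v n) z) s ∧ a • rinner A z z ≤ s ∧ s ≤ b • rinner A z z := by
  rcases hv with ⟨x, hx, hvx⟩ | hv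
  · simpa only [IsFrame, frameTerm, hvx, pairing_toMultiplier, star_rinner] using hx
  · exact hv.2

/-- The analysis operator `U : X → ℓ²(A)`, `U z = (⟨v n, z⟩)`, of a frame or outer frame `v`. -/
def analysisOperator (v : ℕ → MultiplierModule A X) (hv : IsFrameOrOuterFrame v) :
    X →L[ℂ] EllTwo A :=
  LinearMap.mkContinuousOfExistsBound
    { toFun := fun z => (⟨fun n => pairing (v n) z, by
        obtain ⟨a, b, _, _, h⟩ := hv.exists_bounds
        obtain ⟨s, hs, _⟩ := h z
        exact hs.summable⟩ : EllTwo A)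
      map_add' := fun z w => EllTwo.ext fun n => pairing_add (v n) z w
      map_smul' := fun c z => EllTwo.ext fun n => pairing_smul (v n) c z } <| by
    obtain ⟨a, b, ha, hb, h⟩ := hv.exists_bounds
    refine ⟨√b, fun z => ?_⟩
    obtain ⟨s, hs, hs1, hs2⟩ := h z
    have hs0 : 0 ≤ s := hs.nonneg fun n => star_mul_self_nonneg _
    refine le_of_sq_le_sq ?_ (by positivity)
    rw [EllTwo.norm_sq_eq, mul_pow, Real.sq_sqrt hb.le, norm_sq_eq_rinner A]
    refine (congrArg norm hs.tsum_eq).le.trans ?_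
    refine (CStarAlgebra.norm_le_norm_of_nonneg_of_le hs0 hs2).trans ?_
    rw [norm_smul, Real.norm_of_nonneg hb.le]

theorem analysisOperator_apply (v : ℕ → MultiplierModule A X) (hv : IsFrameOrOuterFrame v)
    (z : X) (n : ℕ) : analysisOperator v hv z n = pairing (v n) z := rfl

end Frames

end HilbertFrames

end

open HilbertFrames

open scoped RightActions

/-! The coordinate `z ↦ (V z) n` has an adjoint `A → X`, obtained from that of `V`; this adjoint is
`y n`. Since `⟨x n - y n, z⟩` is a coordinate of `(U - V) z`, the norm estimate is immediate. What
remains are the frame bounds, which are inequalities in the order of `A`, so the norm estimate `‖V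
z‖ ≥ (√a - ‖U - V‖) ‖z‖` alone does not give them.

Paschke's inequality `⟨T z, T z⟩ ≤ ‖T‖² ⟨z, z⟩` (`rinner_map_self_le`) turns operator norms into
order bounds. It needs only `A`-linearity, so it applies to `U - V` without an adjoint of `U`. For
`T = V` it is the upper bound. For the lower bound, the triangle inequality is replaced by `⟨u + w,
u + w⟩ ≤ (1 + ε) ⟨u, u⟩ + (1 + ε⁻¹) ⟨w, w⟩`, applied to `U z = V z + (U - V) z`, with `ε` so large
that `(1 + ε⁻¹) ‖U - V‖² < a`. -/

/-- Comparison of positive elements of a unital C⋆-algebra through the norms of their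
conjugates. -/
theorem CStarAlgebra.le_smul_of_norm_conjugate_le {B : Type*} [CStarAlgebra B] [PartialOrder B]
    [StarOrderedRing B] {p q : B} (hp : 0 ≤ p) (hq : 0 ≤ q) {k : ℝ} (hk : 0 ≤ k)
    (h : ∀ d : B, ‖star d * p * d‖ ≤ k * ‖star d * q * d‖) : p ≤ k • q := by
  -- Adding `ε` makes `q` invertible; conjugation by `u ^ (-1/2)` then turns `u` into `1`, where
  -- order and norm bounds agree.
  have key : ∀ ε : ℝ, 0 < ε → p ≤ k • (q + algebraMap ℝ B ε) := by
    intro ε hε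
    have hε' : IsStrictlyPositive (algebraMap ℝ B ε) := by
      rw [Algebra.algebraMap_eq_smul_one]
      exact IsStrictlyPositive.smul hε isStrictlyPositive_one
    set u : B := q + algebraMap ℝ B ε with hu
    have hus : IsStrictlyPositive u := IsStrictlyPositive.nonneg_add hq hε'
    set d : B := u ^ (-(1 / 2) : ℝ) with hd
    set e : B := u ^ (1 / 2 : ℝ) with he
    have hd0 : 0 ≤ d := CFC.rpow_nonneg
    have he0 : 0 ≤ e := CFC.rpow_nonneg
    have hds : star d = d := (IsSelfAdjoint.of_nonneg hd0).star_eq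
    have hes : star e = e := (IsSelfAdjoint.of_nonneg he0).star_eq
    have hed : e * d = 1 := CFC.rpow_mul_rpow_neg _ hus
    have hde : d * e = 1 := CFC.rpow_neg_mul_rpow _ hus
    have hee : e * e = u := by
      rw [he, ← CFC.rpow_add hus.isUnit]
      norm_num
      exact CFC.rpow_one u hus.nonneg
    have hdud : star d * u * d = 1 := by
      rw [hds, ← hee, ← mul_assoc, hde, one_mul, hed]
    have hqd : ‖star d * q * d‖ ≤ 1 := by
      rw [CStarAlgebra.norm_le_one_iff_of_nonneg _ (star_left_conjugate_nonneg hq d), ← hdud]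
      exact star_left_conjugate_le_conjugate (le_add_of_nonneg_right hε'.nonneg) d
    have hpd : star d * p * d ≤ algebraMap ℝ B k := by
      rw [← CStarAlgebra.norm_le_iff_le_algebraMap _ hk (star_left_conjugate_nonneg hp d)]
      exact (h d).trans (mul_le_of_le_one_right hk hqd)
    have := star_left_conjugate_le_conjugate hpd e
    rw [hes, hds] at this
    calc p = (e * d) * p * (d * e) := by rw [hed, hde, one_mul, mul_one]
      _ = e * (d * p * d) * e := by simp only [mul_assoc]
      _ ≤ e * algebraMap ℝ B k * e := this
      _ = k • u := by
        rw [Algebra.algebraMap_eq_smul_one, mul_smul_comm, mul_one, smul_mul_assoc, hee]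
  -- The order is closed, so `ε` may tend to `0` from the right.
  have hlim : Filter.Tendsto (fun ε : ℝ => k • (q + algebraMap ℝ B ε))
      (nhdsWithin 0 (Set.Ioi 0)) (nhds (k • q)) := by
    have hc : Continuous fun ε : ℝ => k • (q + algebraMap ℝ B ε) := by fun_prop
    simpa using (hc.tendsto 0).mono_left nhdsWithin_le_nhds
  exact ge_of_tendsto hlim (Filter.eventually_of_mem self_mem_nhdsWithin key)

open scoped CStarAlgebra

namespace HilbertFrames

set_option linter.unusedSectionVars false

section

variable {A : Type*} [NonUnitalCStarAlgebra A] [PartialOrder A] [StarOrderedRing A]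
variable {X Y : Type*}
  [NormedAddCommGroup X] [NormedSpace ℂ X] [SMul Aᵐᵒᵖ X] [CStarModule Aᵐᵒᵖ X]
  [NormedAddCommGroup Y] [NormedSpace ℂ Y] [SMul Aᵐᵒᵖ Y] [CStarModule Aᵐᵒᵖ Y]

/-! ### Order inequalities for `A`-valued inner products -/

theorem rinner_sub_left (x y z : X) : rinner A (x - y) z = rinner A x z - rinner A y z := by
  simp [rinner]

theorem map_right_smul_of_mem_adjointableOperators {T : X →L[ℂ] Y}
    (hT : T ∈ adjointableOperators A X Y) (z : X) (c : A) : T (z <• c) = T z <• c := by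
  obtain ⟨S, hS⟩ := hT
  refine eq_of_rinner_right A fun w => ?_
  rw [← star_rinner, hS, rinner_smul_left, ← hS, rinner_smul_right, star_mul, star_star,
    star_rinner]

theorem pairing_right_smul (v : MultiplierModule A X) (z : X) (c : A) :
    pairing v (z <• c) = pairing v z * c :=
  pairing_unique _ _ _ fun b => by
    rw [rinner_smul_right, rinner_apply_eq_pairing, mul_assoc]

/-- The inner square of `z d = r z + z c` where `d = r + c` lies in the unitization of `A`. -/
theorem inr_rinner_unitization_smul (z : X) (d : Unitization ℂ A) :
    ((rinner A (d.fst • z + z <• d.snd) (d.fst • z + z <• d.snd) : A) : Unitization ℂ A) =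
      star d * (rinner A z z : A) * d := by
  induction d using Unitization.ind with
  | inl_add_inr r c =>
    ext
    · simp
    · simp [rinner_add_left, rinner_add_right, rinner_smul_left, rinner_smul_right,
        rinner_csmul_left, rinner_csmul_right, mul_add, add_mul, smul_add, smul_smul,
        smul_mul_assoc]

/-- Paschke's inequality `⟨T z, T z⟩ ≤ ‖T‖² ⟨z, z⟩` for bounded `A`-linear operators. -/
theorem rinner_map_self_le (T : X →L[ℂ] Y) (hT : ∀ (z : X) (c : A), T (z <• c) = T z <• c)
    (z : X) : rinner A (T z) (T z) ≤ ‖T‖ ^ 2 • rinner A z z := by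
  have hz := rinner_self_nonneg A z
  have hTz := rinner_self_nonneg A (T z)
  -- The comparison criterion needs a unit, so the inequality is moved to the unitization.
  rw [← Unitization.inr_le_iff _ _ (IsSelfAdjoint.of_nonneg hTz)
    (IsSelfAdjoint.of_nonneg (smul_nonneg (by positivity) hz)),
    Unitization.inr_smul]
  refine CStarAlgebra.le_smul_of_norm_conjugate_le (Unitization.inr_nonneg_iff.2 hTz)
    (Unitization.inr_nonneg_iff.2 hz) (by positivity) fun d => ?_
  -- Conjugating by `d` replaces `z` by `z d`, and `T` commutes with this action, so the claim
  -- becomes `‖T (z d)‖² ≤ ‖T‖² ‖z d‖²`.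
  rw [← inr_rinner_unitization_smul, ← inr_rinner_unitization_smul, Unitization.norm_inr,
    Unitization.norm_inr, ← hT, ← map_smul, ← map_add, ← norm_sq_eq_rinner, ← norm_sq_eq_rinner,
    ← mul_pow]
  gcongr
  exact T.le_opNorm _

/-- The right side minus the left is `ε⁻¹ ⟨ε u - w, ε u - w⟩`. -/
theorem rinner_add_self_le (u w : Y) {ε : ℝ} (hε : 0 < ε) :
    rinner A (u + w) (u + w) ≤ (1 + ε) • rinner A u u + (1 + ε⁻¹) • rinner A w w := by
  have h : 0 ≤ ε⁻¹ • rinner A ((ε : ℂ) • u - w) ((ε : ℂ) • u - w) :=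
    smul_nonneg (by positivity) (rinner_self_nonneg A _)
  rw [← sub_nonneg]
  convert h using 1
  have hc : ∀ b : A, (ε : ℂ) • b = ε • b := fun b => Complex.coe_smul ε b
  simp only [rinner_add_left, rinner_add_right, rinner_sub_left, rinner_sub_right,
    rinner_csmul_left, rinner_csmul_right, RCLike.star_def, Complex.conj_ofReal, hc]
  match_scalars <;> field_simp <;> ring

/-! ### Multipliers and coordinates of `ℓ²(A)` -/

theorem norm_le_of_adjoint_bound {f : A → X} {p : X → A}
    (hfp : ∀ b z, rinner A (f b) z = star b * p z) {C : ℝ} (hC : 0 ≤ C)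
    (hp : ∀ z, ‖p z‖ ≤ C * ‖z‖) (b : A) : ‖f b‖ ≤ C * ‖b‖ := by
  rcases (norm_nonneg (f b)).eq_or_lt with h0 | h0
  · rw [← h0]
    positivity
  · refine le_of_mul_le_mul_right ?_ h0
    calc ‖f b‖ * ‖f b‖ = ‖star b * p (f b)‖ := by rw [← sq, norm_sq_eq_rinner A, hfp]
      _ ≤ ‖star b‖ * ‖p (f b)‖ := norm_mul_le _ _
      _ ≤ ‖b‖ * (C * ‖f b‖) := by
          rw [norm_star]
          gcongr
          exact hp _
      _ = C * ‖b‖ * ‖f b‖ := by ring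

theorem norm_le_of_norm_pairing_le (v : MultiplierModule A X) {C : ℝ} (hC : 0 ≤ C)
    (h : ∀ z, ‖pairing v z‖ ≤ C * ‖z‖) : ‖v‖ ≤ C :=
  ContinuousLinearMap.opNorm_le_bound v.1 hC
    (norm_le_of_adjoint_bound (rinner_apply_eq_pairing v) hC h)

theorem pairing_sub_left (v w : MultiplierModule A X) (z : X) :
    pairing (v - w) z = pairing v z - pairing w z :=
  pairing_unique _ _ _ fun b => by
    rw [mul_sub, ← rinner_apply_eq_pairing, ← rinner_apply_eq_pairing, ← rinner_sub_left]
    rfl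

/-- A map `A → X` with a bounded adjoint is an element of `M(X)`. -/
theorem exists_multiplier_of_adjoint {f : A → X} {p : X → A}
    (hfp : ∀ b z, rinner A z (f b) = star (p z) * b) {C : ℝ} (hC : 0 ≤ C)
    (hp : ∀ z, ‖p z‖ ≤ C * ‖z‖) :
    ∃ v : MultiplierModule A X, ∀ z, pairing v z = p z := by
  have hfp' : ∀ b z, rinner A (f b) z = star b * p z := fun b z => by
    rw [← star_rinner, hfp, star_mul, star_star]
  -- Linearity of `f` is forced by the adjoint relation, because inner products separate points.
  let g : A →ₗ[ℂ] X :=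
    { toFun := f
      map_add' := fun b c => eq_of_rinner_right A fun z => by
        rw [rinner_add_right, hfp, hfp, hfp, mul_add]
      map_smul' := fun r b => eq_of_rinner_right A fun z => by
        rw [RingHom.id_apply, rinner_csmul_right, hfp, hfp, mul_smul_comm] }
  exact ⟨⟨g.mkContinuous C (norm_le_of_adjoint_bound hfp' hC hp), p, hfp'⟩, fun z => pairing_unique _ _ _ fun b => hfp' b z⟩

theorem EllTwo.norm_coordinate_le (w : EllTwo A) (n : ℕ) : ‖w n‖ ≤ ‖w‖ := by
  refine le_of_sq_le_sq ?_ (norm_nonneg w)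
  rw [EllTwo.norm_sq_eq, sq, ← CStarRing.norm_star_mul_self]
  exact CStarAlgebra.norm_le_norm_of_nonneg_of_le (star_mul_self_nonneg _)
    ((EllTwo.summable_self w).le_tsum n fun m _ => star_mul_self_nonneg (w m))

/-- Without a unit in `A` there is no basis vector at `n`; the sequences with single entry `b` at
`n` replace it, and `b ↦ e` is adjoint to the coordinate map. -/
theorem EllTwo.exists_rinner_eq_coordinate (n : ℕ) (b : A) :
    ∃ e : EllTwo A, ∀ w : EllTwo A, rinner A w e = star (w n) * b := by
  have hmem : (Pi.single n b : ℕ → A) ∈ ellTwoSubmodule A :=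
    summable_of_ne_finset_zero (s := {n}) fun m hm => by
      rw [Pi.single_eq_of_ne (by simpa using hm), mul_zero]
  refine ⟨⟨Pi.single n b, hmem⟩, fun w => (EllTwo.rinner_def w _).trans ?_⟩
  refine (tsum_eq_single n fun m hm => ?_).trans ?_
  · change star (w m) * (Pi.single n b : ℕ → A) m = 0
    rw [Pi.single_eq_of_ne hm, mul_zero]
  · change star (w n) * (Pi.single n b : ℕ → A) n = star (w n) * b
    rw [Pi.single_eq_same]

/-- The coordinates of an adjointable operator into `ℓ²(A)` are pairings with elements of
`M(X)`. -/
theorem exists_pairing_eq_coordinate {V : X →L[ℂ] EllTwo A}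
    (hV : V ∈ adjointableOperators A X (EllTwo A)) (n : ℕ) :
    ∃ y : MultiplierModule A X, ∀ z, pairing y z = V z n := by
  obtain ⟨S, hS⟩ := hV
  choose e he using EllTwo.exists_rinner_eq_coordinate (A := A) n
  -- The multiplier sends `b` to the adjoint of `V` applied to the sequence with single entry `b`.
  exact exists_multiplier_of_adjoint (f := fun b => S (e b)) (C := ‖V‖)
    (fun b z => by rw [← hS, he]) (norm_nonneg V)
    fun z => (EllTwo.norm_coordinate_le _ n).trans (V.le_opNorm z)

/-! ### Stability of frame bounds -/

theorem analysisOperator_right_smul (v : ℕ → MultiplierModule A X) (hv : IsFrameOrOuterFrame v)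
    (z : X) (c : A) : analysisOperator v hv (z <• c) = analysisOperator v hv z <• c :=
  EllTwo.ext fun n => pairing_right_smul (v n) z c

/-- The bounds are the same in both cases; only membership of all `v n` in `X` separates them. -/
theorem IsFrameOrOuterFrame.of_bounds {v : ℕ → MultiplierModule A X}
    (h : ∃ a b : ℝ, 0 < a ∧ 0 < b ∧ ∀ z : X, ∃ s : A,
      HasSum (fun n => frameTerm (v n) z) s ∧ a • rinner A z z ≤ s ∧ s ≤ b • rinner A z z) :
    IsFrameOrOuterFrame v := by
  by_cases hv : ∃ n, v n ∉ Set.range (toMultiplier A (X := X))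
  · exact Or.inr ⟨hv, h⟩
  · push Not at hv
    choose x hx using hv
    obtain rfl : (fun n => toMultiplier A (x n)) = v := funext hx
    refine Or.inl ⟨x, ?_, fun n => rfl⟩
    simpa only [IsFrame, frameTerm, pairing_toMultiplier, star_rinner] using h

/-- A bounded `A`-linear operator close to one bounded below by `a` is bounded below. -/
theorem exists_lower_bound_of_norm_sub_lt {U V : X →L[ℂ] Y} {a : ℝ}
    (hU : ∀ (z : X) (c : A), U (z <• c) = U z <• c)
    (hV : ∀ (z : X) (c : A), V (z <• c) = V z <• c)
    (hUa : ∀ z, a • rinner A z z ≤ rinner A (U z) (U z)) (hUV : ‖U - V‖ < √a) :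
    ∃ c : ℝ, 0 < c ∧ ∀ z, c • rinner A z z ≤ rinner A (V z) (V z) := by
  have hlt : ‖U - V‖ ^ 2 < a := (Real.lt_sqrt (norm_nonneg _)).1 hUV
  -- As `ε → ∞` the factor `1 + ε⁻¹` tends to `1`, so the strict inequality leaves room.
  obtain ⟨ε, hε, hεa⟩ : ∃ ε : ℝ, 0 < ε ∧ (1 + ε⁻¹) * ‖U - V‖ ^ 2 < a := by
    have hlim : Filter.Tendsto (fun ε : ℝ => (1 + ε⁻¹) * ‖U - V‖ ^ 2) Filter.atTop
        (nhds ((1 + 0) * ‖U - V‖ ^ 2)) :=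
      (tendsto_inv_atTop_zero.const_add 1).mul_const _
    rw [add_zero, one_mul] at hlim
    exact ((Filter.eventually_gt_atTop 0).and (hlim.eventually_lt_const hlt)).exists
  refine ⟨(1 + ε)⁻¹ * (a - (1 + ε⁻¹) * ‖U - V‖ ^ 2),
    mul_pos (by positivity) (sub_pos.2 hεa), fun z => ?_⟩
  have hW := rinner_map_self_le (A := A) (U - V) (fun z c => by
    refine eq_of_rinner_right A fun w => ?_
    simp only [_root_.sub_apply, hU, hV, rinner_sub_right, rinner_smul_right, sub_mul]) z
  have h1 := rinner_add_self_le (A := A) (V z) ((U - V) z) hε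
  rw [show V z + (U - V) z = U z by simp] at h1
  have h2 : a • rinner A z z ≤ (1 + ε) • rinner A (V z) (V z) +
      (1 + ε⁻¹) • ‖U - V‖ ^ 2 • rinner A z z :=
    ((hUa z).trans h1).trans (by gcongr)
  rw [mul_smul, inv_smul_le_iff_of_pos (by positivity), sub_smul, mul_smul, sub_le_iff_le_add]
  exact h2

end

end HilbertFrames

theorem theorem5p2 {A : Type*} [NonUnitalCStarAlgebra A] [PartialOrder A] [StarOrderedRing A]
    {X : Type*} [NormedAddCommGroup X] [NormedSpace ℂ X] [SMul Aᵐᵒᵖ X] [CStarModule Aᵐᵒᵖ X]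
    [CompleteSpace X]
    (x : ℕ → MultiplierModule A X) (hx : IsFrameOrOuterFrame x)
    (a : ℝ) (ha : IsOptimalLowerFrameBound x a)
    (V : X →L[ℂ] EllTwo A) (hV : V ∈ adjointableOperators A X (EllTwo A))
    (hUV : ‖analysisOperator x hx - V‖ < √a) :
    ∃ (y : ℕ → MultiplierModule A X) (hy : IsFrameOrOuterFrame y),
      analysisOperator y hy = V ∧
      ∀ n, ‖x n - y n‖ ≤ ‖analysisOperator x hx - V‖ ∧ ‖analysisOperator x hx - V‖ < √a := by
  choose y hy using exists_pairing_eq_coordinate hV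
  have hVlin := map_right_smul_of_mem_adjointableOperators hV
  obtain ⟨c, hc, hcV⟩ := exists_lower_bound_of_norm_sub_lt (A := A)
    (analysisOperator_right_smul x hx) hVlin (fun z => by
      obtain ⟨s, hs, hsz⟩ := ha.1.2 z
      exact hsz.trans hs.tsum_eq.ge) hUV
  have hyf : IsFrameOrOuterFrame y := by
    -- The `+ 1` keeps the upper bound positive when `V = 0`, as happens for `X = 0`.
    refine .of_bounds ⟨c, ‖V‖ ^ 2 + 1, hc, by positivity, fun z =>
      ⟨rinner A (V z) (V z), ?_, hcV z, ?_⟩⟩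
    · simp only [frameTerm, hy]
      exact (EllTwo.summable_self (V z)).hasSum
    · exact (rinner_map_self_le V hVlin z).trans
        (smul_le_smul_of_nonneg_right (by linarith) (rinner_self_nonneg A z))
  refine ⟨y, hyf, ?_, fun n => ⟨?_, hUV⟩⟩
  · ext1 z
    exact EllTwo.ext fun n => hy n z
  · refine norm_le_of_norm_pairing_le _ (norm_nonneg _) fun z => ?_
    rw [pairing_sub_left, hy]
    exact (EllTwo.norm_coordinate_le ((analysisOperator x hx - V) z) n).trans
      (ContinuousLinearMap.le_opNorm _ z)
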